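/- Consider $\ell_1$, the space of absolutely summable real sequences, as a Banach lattice with the norm $\|x\|=\sum_n|x_n|$ and the coordinatewise order. Let $E$ be a separable real Banach space failing the Schur property (that is, some weakly null sequence in $E$ is not norm null). Then no closed linear subspace $M$ of $\ell_1$ such that $E$ is isomorphic (linearly homeomorphic) to $\ell_1/M$ is an ideal of $\ell_1$; that is, for every such $M$ there are $x\in M$ and $y\in\ell_1$ with $|y|\le|x|$ and $y\notin M$. -/

import Mathlib

open Filter Topology

/-- The real Banach space `ℓ₁` of absolutely summable real sequences, with the norm `∑ |x n|`. -/
abbrev Ell1 : Type := lp (fun _ : ℕ => ℝ) 1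

namespace Ell1

theorem memℓp_norm (x : Ell1) : Memℓp (fun n => ‖x n‖ : ℕ → ℝ) 1 :=
  Memℓp.mono (g := fun n => ‖x n‖) (lp.toNorm x).2 (fun n => by simp)

theorem memℓp_sup (x y : Ell1) : Memℓp (fun n => x n ⊔ y n : ℕ → ℝ) 1 :=
  ((memℓp_norm x).add (memℓp_norm y)).mono fun _ =>
    abs_max_le_max_abs_abs.trans (max_le_add_of_nonneg (abs_nonneg _) (abs_nonneg _))

theorem memℓp_inf (x y : Ell1) : Memℓp (fun n => x n ⊓ y n : ℕ → ℝ) 1 :=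
  ((memℓp_norm x).add (memℓp_norm y)).mono fun _ =>
    abs_min_le_max_abs_abs.trans (max_le_add_of_nonneg (abs_nonneg _) (abs_nonneg _))

/-- The usual coordinatewise lattice order of `ℓ₁`. -/
instance instLattice : Lattice Ell1 where
  le x y := ∀ n, x n ≤ y n
  le_refl _ _ := le_rfl
  le_trans _ _ _ h₁ h₂ n := (h₁ n).trans (h₂ n)
  le_antisymm _ _ h₁ h₂ := lp.ext (funext fun n => le_antisymm (h₁ n) (h₂ n))
  sup x y := ⟨fun n => x n ⊔ y n, memℓp_sup x y⟩
  inf x y := ⟨fun n => x n ⊓ y n, memℓp_inf x y⟩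
  le_sup_left _ _ _ := le_sup_left
  le_sup_right _ _ _ := le_sup_right
  sup_le _ _ _ h₁ h₂ n := sup_le (h₁ n) (h₂ n)
  inf_le_left _ _ _ := inf_le_left
  inf_le_right _ _ _ := inf_le_right
  le_inf _ _ _ h₁ h₂ n := le_inf (h₁ n) (h₂ n)

theorem le_def (x y : Ell1) : x ≤ y ↔ ∀ n, x n ≤ y n := Iff.rfl

theorem abs_apply (x : Ell1) (n : ℕ) : (|x| : Ell1) n = |x n| := rfl

end Ell1

/-- An (order) ideal of a Riesz space: a linear subspace `M` which is solid, that is,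
`|y| ≤ |x|` and `x ∈ M` imply `y ∈ M`. -/
def IsOrderIdeal {L : Type*} [AddCommGroup L] [Lattice L] [Module ℝ L]
    (M : Submodule ℝ L) : Prop :=
  LatticeOrderedAddCommGroup.IsSolid (M : Set L)

/-- The Schur property: weakly null sequences are norm null. -/
def SchurProperty (E : Type*) [NormedAddCommGroup E] [NormedSpace ℝ E] : Prop :=
  ∀ x : ℕ → E, Tendsto (fun n => toWeakSpace ℝ E (x n)) atTop (𝓝 0) → Tendsto x atTop (𝓝 0)

namespace Ell1

/-! A closed ideal of `ℓ₁` consists of the sequences vanishing on some set `S`, so it is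
complemented by a coordinate projection, and the quotient embeds in `ℓ₁` through a continuous
section. Since `ℓ₁` has the Schur property, so would `E`. Schur's theorem itself comes from Baire
category on the sign sequences `ℕ → Bool`. -/

theorem summable_norm (x : Ell1) : Summable fun i => ‖x i‖ := by
  simpa using (lp.memℓp x).summable (by simp)

theorem norm_eq_tsum (x : Ell1) : ‖x‖ = ∑' i, ‖x i‖ := by
  simp [lp.norm_eq_tsum_rpow (p := 1) (by simp) x]

/-- Coordinatewise multiplication by a sequence bounded by `1`. -/
noncomputable def scale (a : ℕ → ℝ) (ha : ∀ i, |a i| ≤ 1) : Ell1 →L[ℝ] Ell1 :=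
  lp.mapCLM 1 (fun i => a i • ContinuousLinearMap.id ℝ ℝ) zero_le_one fun i => by
    simpa [norm_smul] using ha i

theorem scale_apply (a : ℕ → ℝ) (ha : ∀ i, |a i| ≤ 1) (x : Ell1) (i : ℕ) :
    scale a ha x i = a i * x i := by
  simp [scale]

/-- The sign encoded by a boolean. -/
def boolSign (b : Bool) : ℝ := if b then 1 else -1

theorem abs_boolSign (b : Bool) : |boolSign b| = 1 := by
  cases b <;> simp [boolSign]

theorem boolSign_decide_mul (t : ℝ) : boolSign (decide (0 ≤ t)) * t = |t| := by
  by_cases h : 0 ≤ t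
  · simp [boolSign, h, abs_of_nonneg]
  · simp [boolSign, h, abs_of_neg (not_le.1 h)]

/-- The functional on `ℓ₁` given by a sequence of signs. -/
noncomputable def signFunctional (b : ℕ → Bool) : Ell1 →L[ℝ] ℝ :=
  lp.tsumCLM ℝ ℕ ℝ ∘L scale (fun i => boolSign (b i)) fun i => (abs_boolSign (b i)).le

theorem signFunctional_apply (b : ℕ → Bool) (x : Ell1) :
    signFunctional b x = ∑' i, boolSign (b i) * x i := by
  simp [signFunctional, scale_apply]

theorem norm_boolSign_mul (b : Bool) (t : ℝ) : ‖boolSign b * t‖ = ‖t‖ := by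
  simp [abs_boolSign]

/-- Makes the sets in the Baire argument closed; the series converges uniformly in `b`, dominated by
`|x i|`. -/
theorem continuous_signFunctional (x : Ell1) : Continuous fun b => signFunctional b x := by
  simp_rw [signFunctional_apply]
  refine continuous_tsum (fun i => ?_) x.summable_norm fun i b => (norm_boolSign_mul _ _).le
  exact ((continuous_of_discreteTopology (f := boolSign)).comp (continuous_apply i)).mul_const _

/-- Functionals with prescribed signs on a finite set of coordinates control the norm up to those
coordinates. -/
theorem norm_le_signFunctional_add (I : Finset ℕ) (b : ℕ → Bool) (x : Ell1) :
    ∃ c : ℕ → Bool, (∀ i ∈ I, c i = b i) ∧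
      ‖x‖ ≤ signFunctional c x + 2 * ∑ i ∈ I, |x i| := by
  classical
  -- Off `I` the signs of `x` recover `|x i|`; on `I` each term loses at most `2 * |x i|`.
  refine ⟨fun i => if i ∈ I then b i else decide (0 ≤ x i), fun i hi => by simp [hi], ?_⟩
  rw [norm_eq_tsum, signFunctional_apply, Finset.mul_sum]
  have hfin : HasSum (fun i => if i ∈ I then 2 * |x i| else 0)
      (∑ i ∈ I, if i ∈ I then 2 * |x i| else 0) :=
    hasSum_sum_of_ne_finset_zero fun i hi => if_neg hi
  have hsum (c : ℕ → Bool) : Summable fun i => boolSign (c i) * x i :=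
    .of_norm (by simpa only [norm_boolSign_mul] using x.summable_norm)
  rw [← Finset.sum_congr rfl fun i hi => if_pos (c := i ∈ I) (e := (0 : ℝ)) hi, ← hfin.tsum_eq,
    ← Summable.tsum_add (hsum _) hfin.summable]
  refine x.summable_norm.tsum_le_tsum (fun i => ?_) ((hsum _).add hfin.summable)
  by_cases hi : i ∈ I
  · have h := neg_abs_le (boolSign (b i) * x i)
    rw [abs_mul, abs_boolSign, one_mul] at h
    simp only [hi, if_true, Real.norm_eq_abs]
    linarith
  · simp [hi, boolSign_decide_mul]

/-- **Schur's theorem**: in `ℓ₁`, a sequence converging to zero against every functional is norm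
null. -/
theorem tendsto_zero_of_forall_functional (x : ℕ → Ell1)
    (hx : ∀ φ : Ell1 →L[ℝ] ℝ, Tendsto (fun n => φ (x n)) atTop (𝓝 0)) :
    Tendsto x atTop (𝓝 0) := by
  rw [Metric.tendsto_atTop']
  intro ε hε
  let F : ℕ → Set (ℕ → Bool) := fun k => {b | ∀ n ≥ k, |signFunctional b (x n)| ≤ ε / 3}
  have hF : ∀ k, IsClosed (F k) := fun k => by
    simp only [F, Set.ofPred_forall]
    exact isClosed_iInter fun n => isClosed_iInter fun _ =>
      isClosed_le (continuous_signFunctional (x n)).abs continuous_const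
  have hU : ⋃ k, F k = Set.univ := Set.eq_univ_of_forall fun b => by
    obtain ⟨k, hk⟩ := Metric.tendsto_atTop.1 (hx (signFunctional b)) (ε / 3) (by positivity)
    exact Set.mem_iUnion.2 ⟨k, fun n hn => by simpa using (hk n hn).le⟩
  -- By Baire, some `F k` contains a basic open box, which constrains only the signs on a finite set
  -- `I`.
  obtain ⟨k, b, hb⟩ := nonempty_interior_of_iUnion_of_closed hF hU
  obtain ⟨I, u, hu, hsub⟩ := isOpen_pi_iff.1 isOpen_interior b hb
  have hcoord : Tendsto (fun n => 2 * ∑ i ∈ I, |x n i|) atTop (𝓝 0) := by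
    have h := (tendsto_finsetSum I fun i _ =>
      (hx (lp.evalCLM ℝ (fun _ : ℕ => ℝ) 1 i)).abs).const_mul 2
    simpa [lp.evalCLM] using h
  obtain ⟨m, hm⟩ := eventually_atTop.1 (hcoord.eventually_lt_const (show 0 < ε / 3 by positivity))
  refine ⟨max k m, fun n hn => ?_⟩
  obtain ⟨c, hc, hle⟩ := norm_le_signFunctional_add I b (x n)
  have hcF : c ∈ F k := interior_subset (hsub fun i hi => by
    rw [hc i hi]; exact (hu i hi).2)
  have h₁ := (le_abs_self _).trans (hcF n ((le_max_left _ _).trans hn.le))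
  have h₂ := hm n ((le_max_right _ _).trans hn.le)
  rw [dist_zero_right]
  linarith

/-- A solid subspace contains the unit vectors at the coordinates where it does not vanish. -/
theorem single_mem_of_isOrderIdeal {M : Submodule ℝ Ell1} (hM : IsOrderIdeal M) {x : Ell1}
    (hx : x ∈ M) {i : ℕ} (hi : x i ≠ 0) (t : ℝ) : lp.single 1 i t ∈ M := by
  have h : (lp.single 1 i (x i) : Ell1) ∈ M := hM hx <| (le_def _ _).2 fun j => by
    rw [abs_apply, abs_apply]
    obtain rfl | hj := eq_or_ne j i
    · rw [lp.single_apply_self]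
    · rw [lp.single_apply_ne _ _ _ hj]; simp
  have h' := M.smul_mem (t / x i) h
  rwa [← lp.single_smul, smul_eq_mul, div_mul_cancel₀ _ hi] at h'

/-- A closed ideal of `ℓ₁` consists of the sequences vanishing on some set of coordinates. -/
theorem exists_mem_iff_of_isClosed_of_isOrderIdeal {M : Submodule ℝ Ell1}
    (hc : IsClosed (M : Set Ell1)) (hM : IsOrderIdeal M) :
    ∃ S : Set ℕ, ∀ x : Ell1, x ∈ M ↔ ∀ i ∈ S, x i = 0 := by
  refine ⟨{i | ∀ y ∈ M, y i = 0}, fun x => ⟨fun hx i hi => hi x hx, fun hx => ?_⟩⟩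
  -- Finite truncations of `x` converge to `x`, so by closedness it suffices that they lie in `M`.
  refine hc.mem_of_tendsto (lp.hasSum_single (p := 1) (by simp) x) (Eventually.of_forall fun s => ?_)
  refine M.sum_mem fun i _ => ?_
  by_cases hi : ∀ y ∈ M, y i = 0
  · rw [hx i hi, lp.single_zero]; exact M.zero_mem
  · push Not at hi
    obtain ⟨y, hy, hyi⟩ := hi
    exact single_mem_of_isOrderIdeal hM hy hyi _

/-- The quotient of `ℓ₁` by a closed ideal has a continuous linear section of the quotient map. -/
theorem exists_section_of_isClosed_of_isOrderIdeal {M : Submodule ℝ Ell1}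
    (hc : IsClosed (M : Set Ell1)) (hM : IsOrderIdeal M) :
    ∃ σ : (Ell1 ⧸ M) →L[ℝ] Ell1, ∀ q, M.mkQL (σ q) = q := by
  classical
  obtain ⟨S, hS⟩ := exists_mem_iff_of_isClosed_of_isOrderIdeal hc hM
  -- Restriction to `S` kills `M` and changes `x` only by an element of `M`, so it descends to a
  -- section.
  let P : Ell1 →L[ℝ] Ell1 := scale (S.indicator 1) fun i => by
    by_cases hi : i ∈ S <;> simp [hi]
  have hP : ∀ x i, P x i = S.indicator 1 i * x i := scale_apply _ _
  refine ⟨M.liftQL P fun x hx => ?_, fun q => ?_⟩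
  · refine lp.ext (funext fun i => ?_)
    by_cases hi : i ∈ S
    · simp [hP, (hS x).1 hx i hi]
    · simp [hP, hi]
  · obtain ⟨x, rfl⟩ := M.mkQ_surjective q
    refine (Submodule.Quotient.eq M).2 ((hS _).2 fun i hi => ?_)
    change P x i - x i = 0
    simp [hP, hi]

end Ell1

/-- Continuous functionals send weakly null sequences to null sequences. -/
theorem tendsto_functional_of_tendsto_toWeakSpace {E : Type*} [NormedAddCommGroup E]
    [NormedSpace ℝ E] {x : ℕ → E}
    (hx : Tendsto (fun n => toWeakSpace ℝ E (x n)) atTop (𝓝 0)) (φ : E →L[ℝ] ℝ) :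
    Tendsto (fun n => φ (x n)) atTop (𝓝 0) := by
  rw [← map_zero φ]
  exact ((WeakBilin.eval_continuous (topDualPairing ℝ E).flip φ).tendsto 0).comp hx

/-- If a separable Banach space `E` fails the Schur property, then no closed subspace `M` of `ℓ₁`
with `E` isomorphic (linearly homeomorphic) to `ℓ₁ / M` is an ideal of the Banach lattice `ℓ₁`. -/
theorem corollary2p9 (E : Type*) [NormedAddCommGroup E] [NormedSpace ℝ E] [CompleteSpace E]
    [TopologicalSpace.SeparableSpace E] (hE : ¬ SchurProperty E)
    (M : Submodule ℝ Ell1) (hM : IsClosed (M : Set Ell1))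
    (hiso : Nonempty (E ≃L[ℝ] (Ell1 ⧸ M))) :
    ¬ IsOrderIdeal M := by
  intro hI
  obtain ⟨e⟩ := hiso
  obtain ⟨σ, hσ⟩ := Ell1.exists_section_of_isClosed_of_isOrderIdeal hM hI
  refine hE fun x hx => ?_
  have h := Ell1.tendsto_zero_of_forall_functional (fun n => σ (e (x n))) fun φ =>
    tendsto_functional_of_tendsto_toWeakSpace hx (φ ∘L σ ∘L (e : E →L[ℝ] Ell1 ⧸ M))
  have h' := ((e.symm.continuous.comp M.mkQL.continuous).tendsto 0).comp h
  simpa only [Function.comp_def, hσ, map_zero, e.symm_apply_apply] using h'
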